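/- Let $G$ be a connected and simply connected finite-dimensional real Lie group acting smoothly (from the left) on a finite-dimensional smooth manifold $M$, and fix $k\in\{1,2,\dots,\infty\}$; "differentiable in $p$" means of class $C^k$ in $p\in M$ (so $C^\infty$ for $k=\infty$). A real function $f(x,p)$, with $x$ in a topological space and $p\in M$, is strongly continuous in $x$ if for every $x_0$, every compact $C\subset M$ and every $\varepsilon>0$ there is a neighbourhood of $x_0$ such that $|f(x_0,p)-f(x,p)|<\varepsilon$ for all $x$ in this neighbourhood and all $p\in C$. A local exponent of $G$ on a neighbourhood $U$ of $e$ is a real function $\xi(r,s,p)$, $r,s\in U$, $p\in M$, strongly continuous in $(r,s)$ and differentiable in $p$, such that $\xi(e,e,p)=0$ and $\xi(r,s,p)+\xi(rs,g,p)=\xi(s,g,r^{-1}p)+\xi(r,sg,p)$ whenever $r,s,g,rs,sg\in U$; it is an exponent of $G$ if $U=G$. Put $\Delta[\zeta](r,s,p)=\zeta(r,p)+\zeta(s,r^{-1}p)-\zeta(rs,p)$. Theorem. Let $\xi,\xi'$ be local exponents of $G$ on $U$ and $U'$ respectively that are equivalent, i.e. on some neighbourhood $V\subset U\cap U'$ of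 $e$ there is a function $\zeta(r,p)$ ($r\in V$, $p\in M$), strongly continuous in $r$ and differentiable in $p$, with $\xi'(r,s,p)=\xi(r,s,p)+\Delta[\zeta](r,s,p)$ for all $p\in M$ and all $r,s\in V$ with $rs\in V$. Let $\xi_1,\xi_1'$ be exponents of $G$ which extend $\xi$ and $\xi'$ respectively. Then there is a function $\zeta_1(r,p)$ on $G\times M$, strongly continuous in $r$ and differentiable in $p$, such that $$\xi_1'(r,s,p)=\xi_1(r,s,p)+\Delta[\zeta_1](r,s,p)\qquad\text{for all } r,s\in G,\ p\in M,$$ and $\zeta_1(r,p)=\zeta(r,p)$ for all $p\in M$ and all $r$ in some neighbourhood of $e$. In particular an extension of a local exponent to an exponent of $G$, when it exists, is unique up to equivalence: any two exponents $\xi_1,\xi_2$ of $G$ extending the same $\xi$ satisfy $\xi_2=\xi_1+\Delta[\zeta_2]$ on $G$ for some $\zeta_2(r,p)$ strongly continuous in $r$ and differentiable in $p$. -/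

import Mathlib

open scoped Manifold ContDiff Topology

/-- A real function `f x p`, given for `x ∈ S` and all `p ∈ M`, is *strongly continuous in `x`*
on `S`: at every `x₀ ∈ S` it is continuous in `x`, uniformly for `p` in any compact subset
of `M`. -/
def StronglyContinuousOn {X M : Type*} [TopologicalSpace X] [TopologicalSpace M]
    (S : Set X) (f : X → M → ℝ) : Prop :=
  ∀ x₀ ∈ S, ∀ C : Set M, IsCompact C → ∀ ε : ℝ, 0 < ε →
    ∀ᶠ x in 𝓝[S] x₀, ∀ p ∈ C, |f x₀ p - f x p| < ε

/-- `Δ[ζ](r, s, p) = ζ(r, p) + ζ(s, r⁻¹ p) - ζ(rs, p)`. -/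
def coboundary {G M : Type*} [Group G] [MulAction G M] (ζ : G → M → ℝ) (r s : G) (p : M) : ℝ :=
  ζ r p + ζ s (r⁻¹ • p) - ζ (r * s) p

/-- `ξ` is a *local exponent* of `G`, with phases of class `C^k` in `p`, defined on the
neighbourhood `U` of the identity: only the values `ξ r s p` with `r, s ∈ U` matter, while `p`
ranges over all of `M`. For `U = Set.univ` this is an exponent of (the whole group) `G`. -/
structure IsExponentOn {F G M : Type*} [NormedAddCommGroup F] [NormedSpace ℝ F]
    [TopologicalSpace G] [Group G] [TopologicalSpace M] [ChartedSpace F M] [MulAction G M]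
    (k : ℕ∞) (U : Set G) (ξ : G → G → M → ℝ) : Prop where
  mem_nhds : U ∈ 𝓝 (1 : G)
  contMDiff : ∀ r ∈ U, ∀ s ∈ U, ContMDiff 𝓘(ℝ, F) 𝓘(ℝ, ℝ) k (ξ r s)
  stronglyContinuous : StronglyContinuousOn (U ×ˢ U) (fun x : G × G => ξ x.1 x.2)
  one_one : ∀ p, ξ 1 1 p = 0
  cocycle : ∀ r ∈ U, ∀ s ∈ U, ∀ g ∈ U, r * s ∈ U → s * g ∈ U → ∀ p,
    ξ r s p + ξ (r * s) g p = ξ s g (r⁻¹ • p) + ξ r (s * g) p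

/-- `ξ' = ξ + Δ[ζ]` on the neighbourhood `V` of the identity, with `ζ` strongly continuous in `r`
and of class `C^k` in `p`. -/
structure IsEquivalenceOn {F G M : Type*} [NormedAddCommGroup F] [NormedSpace ℝ F]
    [TopologicalSpace G] [Group G] [TopologicalSpace M] [ChartedSpace F M] [MulAction G M]
    (k : ℕ∞) (V : Set G) (ξ ξ' : G → G → M → ℝ) (ζ : G → M → ℝ) : Prop where
  mem_nhds : V ∈ 𝓝 (1 : G)
  contMDiff : ∀ r ∈ V, ContMDiff 𝓘(ℝ, F) 𝓘(ℝ, ℝ) k (ζ r)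
  stronglyContinuous : StronglyContinuousOn V ζ
  eq_add : ∀ r ∈ V, ∀ s ∈ V, r * s ∈ V → ∀ p, ξ' r s p = ξ r s p + coboundary ζ r s p

/-- `ξ₁`, given on the whole group, *extends* the local exponent `ξ` defined on `U`. -/
def Extends {G M : Type*} (U : Set G) (ξ ξ₁ : G → G → M → ℝ) : Prop :=
  ∀ r ∈ U, ∀ s ∈ U, ∀ p, ξ₁ r s p = ξ r s p

/-!
The difference `η = ξ₁' - ξ₁` is a two-cocycle of `G` with values in the functions `M → ℝ`, and
`ζ` trivializes it near the identity. The claim is that on a simply connected group a local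
trivialization extends to a global one.

Twisting multiplication by `η` makes `G × (M → ℝ)` into a group, the extension of `G` by `M → ℝ`
(`Multiplier.Extension`). A function `ζ` trivializes `η` exactly where `r ↦ (r, ζ r)` is
multiplicative, so the given `ζ` is a local homomorphism from `G` to this group. The monodromy
principle (`exists_monoidHom_eventually_eq_of_local_hom`) extends the germ at `1` of any local
homomorphism on a simply connected, locally path connected group to a global homomorphism, and no
topology on the target is needed. It is proved by lifting the identity of `G` to a covering space:
the charts of this covering are the translates of the graph of the local homomorphism. The second
component of the global homomorphism is the required `ζ₁`
(`Multiplier.exists_eq_coboundary`).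

Regularity of `ζ₁` needs no analysis beyond the identity. For `x` near `r`,
`ζ₁(x, p) = ζ₁(r, p) + ζ(r⁻¹x, r⁻¹p) - η(r, r⁻¹x, p)`. This gives strong continuity at `r`
at once, and shows that being of class `C^k` is a locally constant property of `r`, hence holds
everywhere on the connected group `G`.

Uniqueness of extensions is the case `ζ = 0`.
-/

/-! ### The monodromy principle for local homomorphisms -/

theorem tendsto_inv_mul_nhds_one {G : Type*} [TopologicalSpace G] [Group G]
    [IsTopologicalGroup G] (r : G) : Filter.Tendsto (fun x => r⁻¹ * x) (𝓝 r) (𝓝 1) :=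
  (continuous_const_mul r⁻¹).tendsto' r 1 (inv_mul_cancel r)

theorem MonoidHom.eq_of_eventually_eq_one {G H : Type*} [TopologicalSpace G] [Group G]
    [IsTopologicalGroup G] [PreconnectedSpace G] [Group H] {f g : G →* H}
    (h : ∀ᶠ w in 𝓝 (1 : G), f w = g w) : f = g := by
  have hc : IsLocallyConstant fun x => f x * (g x)⁻¹ := by
    refine (IsLocallyConstant.iff_eventually_eq _).2 fun x => ?_
    filter_upwards [(tendsto_inv_mul_nhds_one x).eventually h] with y hy
    have hf : f y = f x * f (x⁻¹ * y) := by rw [← map_mul, mul_inv_cancel_left]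
    have hg : g y = g x * g (x⁻¹ * y) := by rw [← map_mul, mul_inv_cancel_left]
    rw [hf, hg, hy]
    group
  ext x
  simpa [mul_inv_eq_one] using hc.apply_eq_of_preconnectedSpace x 1

/-- The covering space of `G` attached to a map `f : G → H` multiplicative on `V`, presented as a
bundle with discrete fibre `H`. The chart at `i` lives on the translate `iW`, where `W W⁻¹ ⊆ V`, and
its coordinate `v` at `x` stands for the element `v * f (i⁻¹ * x)` of `H`; multiplicativity of `f`
makes the change of coordinates independent of `x`. As `f 1 = 1` and the preferred chart at `x` is the one centred at
`x`, a point of the total space over `x` is the element of `H` it stands for. -/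
def localHomBundleCore {G H : Type*} [TopologicalSpace G] [Group G] [IsTopologicalGroup G]
    [Group H] [TopologicalSpace H] [DiscreteTopology H] {V W : Set G} (hW : IsOpen W)
    (hW1 : (1 : G) ∈ W) (hWV : ∀ v ∈ W, ∀ w ∈ W, v * w⁻¹ ∈ V) {f : G → H}
    (hf : ∀ r ∈ V, ∀ s ∈ V, r * s ∈ V → f (r * s) = f r * f s) :
    FiberBundleCore G G H where
  baseSet i := {x | i⁻¹ * x ∈ W}
  isOpen_baseSet i := hW.preimage (continuous_const_mul i⁻¹)
  indexAt x := x
  mem_baseSet_at x := by simpa using hW1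
  coordChange i j _ v := v * f (i⁻¹ * j)
  coordChange_self i _ _ v := by
    have h1 : (1 : G) ∈ V := by simpa using hWV 1 hW1 1 hW1
    have := hf 1 h1 1 h1 (by simpa using h1)
    simpa using this
  continuousOn_coordChange i j :=
    ((continuous_of_discreteTopology (f := fun v : H => v * f (i⁻¹ * j))).comp
      continuous_snd).continuousOn
  coordChange_comp i j k x hx v := by
    have key : ∀ a b : G, a⁻¹ * x ∈ W → b⁻¹ * x ∈ W → a⁻¹ * b ∈ V := fun a b ha hb => by
      simpa [mul_assoc] using hWV _ ha _ hb
    obtain ⟨⟨hi, hj⟩, hk⟩ := hx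
    have hik : i⁻¹ * k = i⁻¹ * j * (j⁻¹ * k) := by group
    rw [mul_assoc, hik, hf _ (key i j hi hj) _ (key j k hj hk) (hik ▸ key i k hi hk)]

/-- Monodromy principle: the germ at `1` of a local homomorphism from a simply connected, locally
path connected group to an abstract group is the germ of a homomorphism. -/
theorem exists_monoidHom_eventually_eq_of_local_hom {G H : Type*} [TopologicalSpace G] [Group G]
    [IsTopologicalGroup G] [SimplyConnectedSpace G] [LocallyPathConnectedSpace G] [Group H]
    {V : Set G} (hV : V ∈ 𝓝 (1 : G)) {f : G → H}
    (hf : ∀ r ∈ V, ∀ s ∈ V, r * s ∈ V → f (r * s) = f r * f s) :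
    ∃ F : G →* H, ∀ᶠ w in 𝓝 (1 : G), F w = f w := by
  -- `H` is an abstract group; the discrete topology makes the bundle a covering.
  let _ : TopologicalSpace H := ⊥
  have : DiscreteTopology H := ⟨rfl⟩
  have h1V : (1 : G) ∈ V := mem_of_mem_nhds hV
  have hf1 : f 1 = 1 := by simpa using hf 1 h1V 1 h1V (by simpa using h1V)
  obtain ⟨N, hN, hNV⟩ := exists_nhds_split_inv hV
  obtain ⟨W, hWN, hW, hW1⟩ := mem_nhds_iff.1 hN
  let Z := localHomBundleCore (V := V) hW hW1
    (fun v hv w hw => by simpa [div_eq_mul_inv] using hNV v (hWN hv) w (hWN hw)) hf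
  have hcov : IsCoveringMap (Bundle.TotalSpace.proj : Bundle.TotalSpace H Z.Fiber → G) :=
    FiberBundle.isCoveringMap
  obtain ⟨σ, ⟨hσ1, hσ⟩, -⟩ := hcov.existsUnique_continuousMap_lifts (ContinuousMap.id G) 1
    (⟨1, (1 : H)⟩ : Bundle.TotalSpace H Z.Fiber) rfl
  have hproj : ∀ x, (σ x).1 = x := fun x => congrFun hσ x
  let F : G → H := fun x => (σ x).2
  have hF1 : F 1 = 1 :=
    congrArg (fun z : Bundle.TotalSpace H Z.Fiber => (show H from z.2)) hσ1
  -- The coordinate of `σ y` in the chart at `x` is `F y * f (y⁻¹ * x)`; being continuous with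
  -- discrete values, it is constant near `x`.
  have hloc : ∀ x, ∀ᶠ y in 𝓝 x, F y * f (y⁻¹ * x) = F x := fun x => by
    have hc : ContinuousAt (fun y => (Z.localTriv x (σ y)).2) x := by
      refine continuous_snd.continuousAt.comp
        (((Z.localTriv x).continuousOn.continuousAt ?_).comp σ.continuous.continuousAt)
      refine (Z.localTriv x).open_source.mem_nhds ?_
      rw [Z.mem_localTriv_source, ← Z.baseSet_at, hproj]
      exact Z.mem_baseSet_at x
    have hval : ∀ y, (Z.localTriv x (σ y)).2 = F y * f (y⁻¹ * x) := fun y => by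
      change F y * f ((σ y).1⁻¹ * x) = _
      rw [hproj]
    have := hc.eventually (p := fun v => v = (Z.localTriv x (σ x)).2)
      ((isOpen_discrete {(Z.localTriv x (σ x)).2}).mem_nhds rfl)
    filter_upwards [this] with y hy
    rw [hval, hval, inv_mul_cancel, hf1, mul_one] at hy
    exact hy
  have hmul : ∀ x, ∀ᶠ w in 𝓝 (1 : G), F (x * w) = F x * f w := fun x => by
    have hx : Filter.Tendsto (fun w => x * w) (𝓝 1) (𝓝 x) :=
      (continuous_const_mul x).tendsto' 1 x (mul_one x)
    have hinv : Filter.Tendsto (fun w : G => w⁻¹) (𝓝 1) (𝓝 1) :=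
      continuous_inv.tendsto' 1 1 inv_one
    filter_upwards [hx.eventually (hloc x), hV, hinv.eventually hV] with w hw hwV hwV'
    have hww : f w⁻¹ * f w = 1 := by
      rw [← hf _ hwV' _ hwV (by simpa using h1V), inv_mul_cancel, hf1]
    rw [← hw, mul_assoc]
    simp [hww]
  refine ⟨MonoidHom.mk' F fun x y => ?_, ?_⟩
  -- `F (x * y) = F x * F y` holds at `y = 1`, and `hmul` propagates it over the connected `G`.
  · have hc : IsLocallyConstant fun y => F (x * y) * (F y)⁻¹ := by
      refine (IsLocallyConstant.iff_eventually_eq _).2 fun y => ?_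
      have hy := tendsto_inv_mul_nhds_one y
      filter_upwards [hy.eventually (hmul (x * y)), hy.eventually (hmul y)] with z h₁ h₂
      rw [mul_assoc, mul_inv_cancel_left] at h₁
      rw [mul_inv_cancel_left] at h₂
      rw [h₁, h₂]
      group
    have := hc.apply_eq_of_preconnectedSpace y 1
    simpa [hF1, mul_inv_eq_iff_eq_mul] using this
  · filter_upwards [hmul 1] with w hw
    simpa [hF1] using hw

/-! ### The group extension defined by a multiplier -/

/-- A normalized two-cocycle on `G` with values in the `G`-module of all functions `M → ℝ`, on which
`r` acts by `φ ↦ φ (r⁻¹ • ·)`. It carries no regularity condition. -/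
structure Multiplier (G M : Type*) [Group G] [MulAction G M] where
  toFun : G → G → M → ℝ
  one_one : ∀ p, toFun 1 1 p = 0
  cocycle : ∀ r s g p, toFun r s p + toFun (r * s) g p = toFun s g (r⁻¹ • p) + toFun r (s * g) p

namespace Multiplier

variable {G M : Type*} [Group G] [MulAction G M]

/-- The elements of the extension of `G` by the additive group of functions `M → ℝ` defined by the
multiplier `η`: pairs of an element of `G` and a phase. The product is
`(r, φ) (s, ψ) = (rs, φ + ψ (r⁻¹ • ·) - η r s)`; the sign of `η` is chosen so that `r ↦ (r, ζ r)` is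
a homomorphism exactly when `η` is the coboundary of `ζ`. -/
@[ext]
structure Extension (η : Multiplier G M) where
  base : G
  phase : M → ℝ

variable (η : Multiplier G M)

theorem one_left (g : G) (p : M) : η.toFun 1 g p = 0 := by
  have := η.cocycle 1 1 g p
  simp only [mul_one, one_mul, inv_one, one_smul, η.one_one] at this
  linarith

theorem one_right (r : G) (p : M) : η.toFun r 1 p = 0 := by
  have := η.cocycle r 1 1 p
  simp only [mul_one, η.one_one] at this
  linarith

instance : Mul η.Extension where
  mul x y := ⟨x.base * y.base, fun p =>
    x.phase p + y.phase (x.base⁻¹ • p) - η.toFun x.base y.base p⟩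

instance : One η.Extension where
  one := ⟨1, fun _ => 0⟩

instance : Inv η.Extension where
  inv x := ⟨x.base⁻¹, fun p =>
    -x.phase (x.base • p) + η.toFun x.base⁻¹ x.base p⟩

theorem base_mul (x y : η.Extension) : (x * y).base = x.base * y.base := rfl

theorem phase_mul (x y : η.Extension) (p : M) :
    (x * y).phase p = x.phase p + y.phase (x.base⁻¹ • p) - η.toFun x.base y.base p := rfl

instance : Group η.Extension :=
  Group.ofLeftAxioms
    (fun x y z => Extension.ext (mul_assoc _ _ _) <| funext fun p => by
      have := η.cocycle x.base y.base z.base p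
      simp only [phase_mul, base_mul, mul_inv_rev, mul_smul]
      linarith)
    (fun x => Extension.ext (one_mul _) <| funext fun p => by
      change (0 : ℝ) + x.phase ((1 : G)⁻¹ • p) - η.toFun 1 x.base p = x.phase p
      simp [one_left])
    (fun x => Extension.ext (inv_mul_cancel _) <| funext fun p => by
      change -x.phase (x.base • p) + η.toFun x.base⁻¹ x.base p + x.phase (x.base⁻¹⁻¹ • p) -
        η.toFun x.base⁻¹ x.base p = 0
      rw [inv_inv]
      ring)

/-- The quotient homomorphism of the extension onto `G`. -/
def Extension.projection : η.Extension →* G where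
  toFun := base
  map_one' := rfl
  map_mul' _ _ := rfl

/-- On a simply connected group, a multiplier that is a coboundary near the identity is a
coboundary, and the trivializing function can be chosen with a prescribed germ at the identity. -/
theorem exists_eq_coboundary [TopologicalSpace G] [IsTopologicalGroup G] [SimplyConnectedSpace G]
    [LocallyPathConnectedSpace G] {V : Set G} (hV : V ∈ 𝓝 (1 : G)) {ζ : G → M → ℝ}
    (hζ : ∀ r ∈ V, ∀ s ∈ V, r * s ∈ V → ∀ p, η.toFun r s p = coboundary ζ r s p) :
    ∃ ζ₁ : G → M → ℝ, (∀ r s p, η.toFun r s p = coboundary ζ₁ r s p) ∧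
      ∀ᶠ w in 𝓝 (1 : G), ζ₁ w = ζ w := by
  obtain ⟨F, hF⟩ := exists_monoidHom_eventually_eq_of_local_hom hV
    (f := fun r => (⟨r, ζ r⟩ : η.Extension)) (fun r hr s hs hrs =>
      Extension.ext rfl <| funext fun p => by
        have := hζ r hr s hs hrs p
        rw [coboundary] at this
        change ζ (r * s) p = ζ r p + ζ s (r⁻¹ • p) - η.toFun r s p
        linarith)
  have hbase : (Extension.projection η).comp F = MonoidHom.id G :=
    MonoidHom.eq_of_eventually_eq_one (hF.mono fun w hw => congrArg Extension.base hw)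
  have hb : ∀ r, (F r).base = r := fun r => DFunLike.congr_fun hbase r
  refine ⟨fun r => (F r).phase, fun r s p => ?_, hF.mono fun w hw => congrArg Extension.phase hw⟩
  rw [coboundary, map_mul, phase_mul, hb, hb]
  ring

end Multiplier

/-! ### Regularity of the trivializing function -/

theorem StronglyContinuousOn.sub {X M : Type*} [TopologicalSpace X] [TopologicalSpace M]
    {S : Set X} {f g : X → M → ℝ} (hf : StronglyContinuousOn S f)
    (hg : StronglyContinuousOn S g) : StronglyContinuousOn S fun x p => f x p - g x p := by
  intro x hx C hC ε hε
  filter_upwards [hf x hx C hC (ε / 2) (half_pos hε), hg x hx C hC (ε / 2) (half_pos hε)]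
    with y h₁ h₂ p hp
  have h₁ := abs_lt.1 (h₁ p hp)
  have h₂ := abs_lt.1 (h₂ p hp)
  exact abs_lt.2 ⟨by linarith, by linarith⟩

theorem IsExponentOn.sub {F G M : Type*} [NormedAddCommGroup F] [NormedSpace ℝ F]
    [TopologicalSpace G] [Group G] [TopologicalSpace M] [ChartedSpace F M] [MulAction G M] {k : ℕ∞}
    {U : Set G} {ξ ξ' : G → G → M → ℝ} (hξ' : IsExponentOn (F := F) k U ξ')
    (hξ : IsExponentOn (F := F) k U ξ) :
    IsExponentOn (F := F) k U fun r s p => ξ' r s p - ξ r s p where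
  mem_nhds := hξ.mem_nhds
  contMDiff r hr s hs := (hξ'.contMDiff r hr s hs).sub (hξ.contMDiff r hr s hs)
  stronglyContinuous := hξ'.stronglyContinuous.sub hξ.stronglyContinuous
  one_one p := by rw [hξ'.one_one, hξ.one_one, sub_zero]
  cocycle r hr s hs g hg hrs hsg p := by
    have h₁ := hξ.cocycle r hr s hs g hg hrs hsg p
    have h₂ := hξ'.cocycle r hr s hs g hg hrs hsg p
    linarith

section

variable {F G M : Type*} [NormedAddCommGroup F] [NormedSpace ℝ F] [TopologicalSpace G] [Group G]
  [IsTopologicalGroup G] [TopologicalSpace M] [ChartedSpace F M] [MulAction G M] {k : ℕ∞}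
  {η : G → G → M → ℝ} {ζ ζ₁ : G → M → ℝ} {V : Set G}

/-- If `η = Δ[ζ₁]` is strongly continuous, so is `ζ₁` as soon as it is near the identity. The
compact set `C` at `r` is compared with the compact set `r⁻¹ • C` at the identity. -/
theorem stronglyContinuousOn_univ_of_coboundary [ContinuousConstSMul G M]
    (hη : StronglyContinuousOn (Set.univ ×ˢ Set.univ) fun x : G × G => η x.1 x.2)
    (hη₁ : ∀ r p, η r 1 p = 0)
    (hV : V ∈ 𝓝 (1 : G)) (hζ : StronglyContinuousOn V ζ) (hζ₁ : ζ 1 = 0)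
    (heq : ∀ r s p, η r s p = coboundary ζ₁ r s p) (hloc : ∀ᶠ w in 𝓝 (1 : G), ζ₁ w = ζ w) :
    StronglyContinuousOn Set.univ ζ₁ := by
  intro r _ C hC ε hε
  rw [nhdsWithin_univ]
  have hζ' := hζ 1 (mem_of_mem_nhds hV) _ (hC.image (continuous_const_smul r⁻¹)) (ε / 2)
    (half_pos hε)
  rw [nhdsWithin_eq_nhds.2 hV] at hζ'
  have hη' := hη (r, 1) ⟨trivial, trivial⟩ C hC (ε / 2) (half_pos hε)
  rw [Set.univ_prod_univ, nhdsWithin_univ] at hη'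
  have hr := tendsto_inv_mul_nhds_one r
  have hr' : Filter.Tendsto (fun x => (r, r⁻¹ * x)) (𝓝 r) (𝓝 (r, 1)) :=
    (by fun_prop : Continuous fun x : G => (r, r⁻¹ * x)).tendsto' _ _ (by simp)
  filter_upwards [hr.eventually hζ', hr'.eventually hη', hr.eventually hloc] with x h₁ h₂ h₃ p hp
  have h₁ := abs_lt.1 (h₁ (r⁻¹ • p) ⟨p, hp, rfl⟩)
  have h₂ := abs_lt.1 (h₂ p hp)
  have h := heq r (r⁻¹ * x) p
  rw [coboundary, mul_inv_cancel_left, h₃] at h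
  simp only [hη₁, hζ₁, Pi.zero_apply] at h₁ h₂
  exact abs_lt.2 ⟨by linarith, by linarith⟩

/-- If `η = Δ[ζ₁]` is of class `C^k` in `p`, so is `ζ₁` as soon as it is near the identity: `ζ₁ x`
and `ζ₁ r` differ by a function of class `C^k` when `x` is near `r`, and `G` is connected. -/
theorem contMDiff_of_coboundary [PreconnectedSpace G]
    (hsmul : ∀ g : G, ContMDiff 𝓘(ℝ, F) 𝓘(ℝ, F) k fun p : M => g • p)
    (hη : ∀ r s, ContMDiff 𝓘(ℝ, F) 𝓘(ℝ, ℝ) k (η r s))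
    (hV : V ∈ 𝓝 (1 : G)) (hζ : ∀ r ∈ V, ContMDiff 𝓘(ℝ, F) 𝓘(ℝ, ℝ) k (ζ r))
    (heq : ∀ r s p, η r s p = coboundary ζ₁ r s p) (hloc : ∀ᶠ w in 𝓝 (1 : G), ζ₁ w = ζ w)
    (r : G) : ContMDiff 𝓘(ℝ, F) 𝓘(ℝ, ℝ) k (ζ₁ r) := by
  have hc : IsLocallyConstant fun r => ContMDiff 𝓘(ℝ, F) 𝓘(ℝ, ℝ) k (ζ₁ r) := by
    refine (IsLocallyConstant.iff_eventually_eq _).2 fun r => ?_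
    have hr := tendsto_inv_mul_nhds_one r
    filter_upwards [hr.eventually hloc, hr.eventually hV] with x h₁ h₂
    have hx : ContMDiff 𝓘(ℝ, F) 𝓘(ℝ, ℝ) k
        fun p => ζ (r⁻¹ * x) (r⁻¹ • p) - η r (r⁻¹ * x) p :=
      ((hζ _ h₂).comp (hsmul r⁻¹)).sub (hη _ _)
    have h : ∀ p, ζ₁ x p = ζ₁ r p + (ζ (r⁻¹ * x) (r⁻¹ • p) - η r (r⁻¹ * x) p) := fun p => by
      rw [heq r (r⁻¹ * x) p, coboundary, mul_inv_cancel_left, h₁]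
      ring
    refine propext ⟨fun hc => ?_, fun hc => ?_⟩
    · exact (hc.sub hx).congr fun p => by rw [h]; ring
    · exact (hc.add hx).congr h
  refine (hc.apply_eq_of_preconnectedSpace r 1).mpr ?_
  rw [hloc.self_of_nhds]
  exact hζ 1 (mem_of_mem_nhds hV)

/-- Two exponents of a simply connected group that are equivalent near the identity are equivalent,
by a function with the same germ at the identity. -/
theorem IsEquivalenceOn.exists_univ [SimplyConnectedSpace G] [LocallyPathConnectedSpace G]
    (hsmul : ∀ g : G, ContMDiff 𝓘(ℝ, F) 𝓘(ℝ, F) k fun p : M => g • p)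
    {ξ₁ ξ₁' : G → G → M → ℝ} (hζ : IsEquivalenceOn (F := F) k V ξ₁ ξ₁' ζ)
    (hξ₁ : IsExponentOn (F := F) k Set.univ ξ₁) (hξ₁' : IsExponentOn (F := F) k Set.univ ξ₁') :
    ∃ ζ₁ : G → M → ℝ, IsEquivalenceOn (F := F) k Set.univ ξ₁ ξ₁' ζ₁ ∧
      ∀ᶠ w in 𝓝 (1 : G), ζ₁ w = ζ w := by
  have : ContinuousConstSMul G M := ⟨fun g => (hsmul g).continuous⟩
  have hη := hξ₁'.sub hξ₁
  let η : Multiplier G M :=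
    { toFun := fun r s p => ξ₁' r s p - ξ₁ r s p
      one_one := hη.one_one
      cocycle := fun r s g p =>
        hη.cocycle r trivial s trivial g trivial trivial trivial p }
  have hcob : ∀ r ∈ V, ∀ s ∈ V, r * s ∈ V → ∀ p, η.toFun r s p = coboundary ζ r s p :=
    fun r hr s hs hrs p => sub_eq_of_eq_add' (hζ.eq_add r hr s hs hrs p)
  have h1 : (1 : G) ∈ V := mem_of_mem_nhds hζ.mem_nhds
  have hζ1 : ζ 1 = 0 := funext fun p => by
    have := hcob 1 h1 1 h1 (by simpa using h1) p
    rw [η.one_one, coboundary, inv_one, one_smul, mul_one] at this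
    simpa using this.symm
  obtain ⟨ζ₁, heq, hloc⟩ := η.exists_eq_coboundary hζ.mem_nhds hcob
  refine ⟨ζ₁, ⟨Filter.univ_mem, fun r _ => ?_, ?_, fun r _ s _ _ p => ?_⟩, hloc⟩
  · exact contMDiff_of_coboundary hsmul (fun r s => hη.contMDiff r trivial s trivial)
      hζ.mem_nhds hζ.contMDiff heq hloc r
  · exact stronglyContinuousOn_univ_of_coboundary hη.stronglyContinuous η.one_right
      hζ.mem_nhds hζ.stronglyContinuous hζ1 heq hloc
  · exact eq_add_of_sub_eq' (heq r s p)

end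

theorem theorem4 {E F : Type*}
    [NormedAddCommGroup E] [NormedSpace ℝ E] [FiniteDimensional ℝ E]
    [NormedAddCommGroup F] [NormedSpace ℝ F] [FiniteDimensional ℝ F]
    {G : Type*} [TopologicalSpace G] [ChartedSpace E G] [Group G] [LieGroup 𝓘(ℝ, E) ∞ G]
    [ConnectedSpace G] [SimplyConnectedSpace G]
    {M : Type*} [TopologicalSpace M] [ChartedSpace F M] [IsManifold 𝓘(ℝ, F) ∞ M]
    [MulAction G M] [ContMDiffSMul 𝓘(ℝ, E) 𝓘(ℝ, F) ∞ G M]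
    (k : ℕ∞) (hk : 1 ≤ k)
    (U U' V : Set G) (ξ ξ' : G → G → M → ℝ) (ζ : G → M → ℝ)
    (hξ : IsExponentOn (F := F) k U ξ) (hξ' : IsExponentOn (F := F) k U' ξ')
    (hVU : V ⊆ U ∩ U') (hζ : IsEquivalenceOn (F := F) k V ξ ξ' ζ)
    (ξ₁ ξ₁' : G → G → M → ℝ)
    (hξ₁ : IsExponentOn (F := F) k Set.univ ξ₁) (hξ₁' : IsExponentOn (F := F) k Set.univ ξ₁')
    (hext : Extends U ξ ξ₁) (hext' : Extends U' ξ' ξ₁') :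
    (∃ ζ₁ : G → M → ℝ, IsEquivalenceOn (F := F) k Set.univ ξ₁ ξ₁' ζ₁ ∧
      ∃ W ∈ 𝓝 (1 : G), W ⊆ V ∧ ∀ r ∈ W, ∀ p, ζ₁ r p = ζ r p) ∧
    (∀ ξ₂ : G → G → M → ℝ, IsExponentOn (F := F) k Set.univ ξ₂ → Extends U ξ ξ₂ →
      ∃ ζ₂ : G → M → ℝ, IsEquivalenceOn (F := F) k Set.univ ξ₁ ξ₂ ζ₂) := by
  have : IsTopologicalGroup G := topologicalGroup_of_lieGroup 𝓘(ℝ, E) ∞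
  have : LocallyPathConnectedSpace G := ChartedSpace.locallyPathConnectedSpace E G
  have hsmul : ∀ g : G, ContMDiff 𝓘(ℝ, F) 𝓘(ℝ, F) k fun p : M => g • p := fun g =>
    ((contMDiff_smul (I := 𝓘(ℝ, E)) (I' := 𝓘(ℝ, F)) (n := ∞) (G := G) (M := M)).comp
      (contMDiff_const.prodMk contMDiff_id)).of_le (by exact_mod_cast le_top)
  refine ⟨?_, fun ξ₂ hξ₂ hext₂ => ?_⟩
  · have hζ' : IsEquivalenceOn (F := F) k V ξ₁ ξ₁' ζ :=
      { hζ with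
        eq_add := fun r hr s hs hrs p => by
          rw [hext r (hVU hr).1 s (hVU hs).1, hext' r (hVU hr).2 s (hVU hs).2]
          exact hζ.eq_add r hr s hs hrs p }
    obtain ⟨ζ₁, h, hloc⟩ := hζ'.exists_univ hsmul hξ₁ hξ₁'
    exact ⟨ζ₁, h, _, Filter.inter_mem hζ.mem_nhds hloc, fun r hr => hr.1,
      fun r hr p => congrFun hr.2 p⟩
  · have hζ₀ : IsEquivalenceOn (F := F) k U ξ₁ ξ₂ fun _ _ => 0 :=
      { mem_nhds := hξ.mem_nhds
        contMDiff := fun _ _ => contMDiff_const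
        stronglyContinuous := fun _ _ _ _ ε hε => by simp [hε]
        eq_add := fun r hr s hs _ p => by
          simp [coboundary, hext r hr s hs, hext₂ r hr s hs] }
    obtain ⟨ζ₂, h, -⟩ := hζ₀.exists_univ hsmul hξ₁ hξ₂
    exact ⟨ζ₂, h⟩
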